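/- Let $p$ be a prime and let $G$ be a finite group with a split $BN$-pair of characteristic $p$ (for example, a finite group of Lie type defined in characteristic $p$). That is, $G$ has a $BN$-pair $(B,N)$ such that, with $T=B\cap N$ and $U$ the largest normal $p$-subgroup of $B$, the group $T$ is abelian, $B=U\rtimes T$, and $\bigcap_{n\in N}nBn^{-1}=T$. Let $W=N/T$ be the Weyl group. Let $k$ be an algebraically closed field of characteristic $r>0$ with $r\neq p$. For a one-dimensional $kT$-module $X$, let ${\rm Irr}_k(G|(T,X))$ denote the principal series of $X$: the irreducible $kG$-modules $Y$ such that $X$ is a composition factor of the $kT$-module $Y^U$ of $U$-fixed points (the Harish-Chandra restriction of $Y$ to $T$). Assume that $r\nmid |B|$. If $X$ is a one-dimensional $kT$-module and $Y$ and $V$ are irreducible $kG$-modules which both belong to ${\rm Irr}_k(G|(T,X))$, then $$\dim_k {\rm Ext}^1_{kG}(Y,V)\leq |W|.$$ -/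

import Mathlib

open CategoryTheory
open scoped Pointwise

universe u v w

/-- A `BN`-pair (Tits system) in a group `G`: subgroups `B` and `N` and a set `S` of elements of
`W = N / (B ∩ N)` satisfying the usual axioms. -/
structure BNPair (G : Type v) [Group G] where
  B : Subgroup G
  N : Subgroup G
  /-- `G` is generated by `B` and `N`. -/
  sup_eq_top : B ⊔ N = ⊤
  /-- `B ∩ N` is normal in `N`. -/
  [normal : ((B ⊓ N).subgroupOf N).Normal]
  /-- The distinguished generators of `W = N / (B ∩ N)`. -/
  S : Set (N ⧸ (B ⊓ N).subgroupOf N)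
  closure_S : Subgroup.closure S = ⊤
  orderOf_S : ∀ s ∈ S, orderOf s = 2
  /-- `n B n⁻¹ ≠ B` whenever `n` represents an element of `S`. -/
  conj_ne : ∀ n : N, (n : N ⧸ (B ⊓ N).subgroupOf N) ∈ S → MulAut.conj (n : G) • B ≠ B
  /-- `n B m ⊆ B n m B ∪ B m B` whenever `n` represents an element of `S` and `m ∈ N`. -/
  mul_mem : ∀ n : N, (n : N ⧸ (B ⊓ N).subgroupOf N) ∈ S → ∀ m : N, ∀ b ∈ B,
    (n : G) * b * m ∈ DoubleCoset.doubleCoset ((n : G) * m) (B : Set G) (B : Set G) ∪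
      DoubleCoset.doubleCoset (m : G) (B : Set G) (B : Set G)

/-- The torus `T = B ∩ N`. -/
abbrev BNPair.T {G : Type v} [Group G] (D : BNPair G) : Subgroup G := D.B ⊓ D.N

/-- The Weyl group `W = N / T`. -/
abbrev BNPair.W {G : Type v} [Group G] (D : BNPair G) : Type v := D.N ⧸ D.T.subgroupOf D.N

/-- A split `BN`-pair of characteristic `p`: `B = U ⋊ T`, where `U` is the largest normal
`p`-subgroup of `B` and `T = B ∩ N` is abelian, and the intersection of the `N`-conjugates of `B`
is `T`. -/
structure SplitBNPair (p : ℕ) (G : Type v) [Group G] extends BNPair G where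
  U : Subgroup G
  U_le_B : U ≤ B
  U_normal : (U.subgroupOf B).Normal
  U_isPGroup : IsPGroup p U
  U_largest : ∀ Q : Subgroup G, Q ≤ B → (Q.subgroupOf B).Normal → IsPGroup p Q → Q ≤ U
  U_sup_T : U ⊔ (B ⊓ N) = B
  U_inf_T : U ⊓ (B ⊓ N) = ⊥
  T_comm : ∀ s ∈ B ⊓ N, ∀ t ∈ B ⊓ N, s * t = t * s
  iInf_conj : ⨅ n : N, MulAut.conj (n : G) • B = B ⊓ N

section

variable {k : Type u} [Field k]

/-- `σ` is a composition factor of `ρ`: it is irreducible and isomorphic to a subquotient of `ρ`,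
i.e. it is a quotient of a subrepresentation of `ρ`. -/
def IsCompositionFactor {H : Type v} [Group H] {X : Type*} [AddCommGroup X] [Module k X]
    {M : Type*} [AddCommGroup M] [Module k M]
    (σ : Representation k H X) (ρ : Representation k H M) : Prop :=
  σ.IsIrreducible ∧ ∃ (A : Subrepresentation ρ) (f : A.toRepresentation.IntertwiningMap σ),
    Function.Surjective f

variable {p : ℕ} {G : Type v} [Group G] (D : SplitBNPair p G)

/-- The `U`-fixed points are stable under `T`, since `T ≤ B` normalizes `U`. -/
theorem SplitBNPair.invariants_le_comap {M : Type*} [AddCommGroup M] [Module k M]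
    (ρ : Representation k G M) (t : D.T) :
    Representation.invariants (ρ.comp D.U.subtype) ≤
      (Representation.invariants (ρ.comp D.U.subtype)).comap ((ρ.comp D.T.subtype) t) := by
  rintro x hx ⟨y, hy⟩
  have ht : (t : G) ∈ D.B := t.2.1
  have h := D.U_normal.conj_mem ⟨y, D.U_le_B hy⟩ hy ⟨(t : G)⁻¹, inv_mem ht⟩
  have h' : (t : G)⁻¹ * y * t ∈ D.U := by
    simpa [Subgroup.mem_subgroupOf] using h
  have hx' : ρ ((t : G)⁻¹ * y * t) x = x := hx ⟨_, h'⟩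
  change ρ y (ρ t x) = ρ t x
  conv_rhs => rw [← hx']
  rw [← Module.End.mul_apply, ← Module.End.mul_apply, ← map_mul, ← map_mul]
  congr 2
  group

/-- Harish-Chandra restriction `*R_T^G`: the representation of `T` on the `U`-fixed points. -/
noncomputable def SplitBNPair.hcRestriction {M : Type*} [AddCommGroup M] [Module k M]
    (ρ : Representation k G M) : Representation k D.T (Representation.invariants (ρ.comp D.U.subtype)) :=
  Representation.subrepresentation (ρ.comp D.T.subtype) _ (D.invariants_le_comap ρ)

/-- Membership in the principal series `Irr_k(G | (T, X))`: the representation `ρ` of `G` is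
irreducible and `X` is a composition factor of its Harish-Chandra restriction to `T`. (The
requirement that `T` be minimal among the Levi subgroups with nonzero Harish-Chandra restriction
is automatic, because every `N`-conjugate of a standard Levi subgroup contains `T`.) -/
def SplitBNPair.InPrincipalSeries {X : Type*} [AddCommGroup X] [Module k X]
    (σ : Representation k D.T X) {M : Type*} [AddCommGroup M] [Module k M]
    (ρ : Representation k G M) : Prop :=
  ρ.IsIrreducible ∧ IsCompositionFactor σ (D.hcRestriction ρ)

end

/-- Ext-groups exist in the category of representations, as it has enough projectives. -/
instance Rep.hasExt (k : Type u) (G : Type v) [Field k] [Group G] :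
    HasExt.{max u v} (Rep.{max u v} k G) :=
  haveI : EnoughProjectives (Rep.{max u v} k G) :=
    Rep.equivalenceModuleMonoidAlgebra.enoughProjectives_iff.2
      ModuleCat.enoughProjectives.{max u v}
  hasExt_of_enoughProjectives _

/-! Since `r` does not divide the order of `B`, averaging over `B` and `T` splits off eigenspaces.
Inflate `X` to a character χ of `B`; then `Y` and `V` each contain a χ-eigenvector of `B`. The
module `P` induced from χ is projective and maps onto `Y`, with kernel `K` say, so Ext¹(Y, V) is a
quotient of Hom(K, V) (`exists_surjective_to_ext_one`). Fix a functional l on `V` that transforms by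
χ and is nonzero on a χ-eigenvector. As `V` is irreducible, g ↦ l ∘ g embeds Hom(K, V) into the
χ-equivariant functionals on `K`. These extend to `P` (`exists_equivariant_extension`), where by the
Bruhat decomposition they are determined by their values at the translates `w e` of the generator
(`BNPair.functional_eq_zero`). Hence the bound |W|. -/

/-! ### Averaging against a linear character -/

section Averaging

variable {k : Type*} [Field k] {H : Type*} [Group H]

/-- The projection of a representation of a finite group onto the `χ`-eigenspace, for a linear
character `χ`. It is a projection when the order of the group is invertible. -/
noncomputable def eigenProj {M : Type*} [AddCommGroup M] [Module k M] (ρ : Representation k H M)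
    (χ : H →* kˣ) : M →ₗ[k] M :=
  (Nat.card H : k)⁻¹ • ∑ᶠ h : H, ((χ h)⁻¹ : kˣ) • ρ h

variable {M : Type*} [AddCommGroup M] [Module k M] {ρ : Representation k H M} {χ : H →* kˣ}

theorem eigenProj_apply [Fintype H] (ρ : Representation k H M) (χ : H →* kˣ) (m : M) :
    eigenProj ρ χ m = (Nat.card H : k)⁻¹ • ∑ h : H, ((χ h)⁻¹ : kˣ) • ρ h m := by
  simp [eigenProj, finsum_eq_sum_of_fintype]

/-- Reindex the sum by left translation. Invertibility of the order is not needed: if it is zero in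
`k`, so is its inverse, and both sides vanish. -/
theorem apply_eigenProj [Finite H] (h : H) (m : M) :
    ρ h (eigenProj ρ χ m) = χ h • eigenProj ρ χ m := by
  cases nonempty_fintype H
  rw [eigenProj_apply, (ρ h).map_smul, smul_comm (χ h), map_sum, Finset.smul_sum (r := χ h)]
  have key := Fintype.sum_equiv (Equiv.mulLeft h)
    (fun x => ρ h (((χ x)⁻¹ : kˣ) • ρ x m)) (fun x => χ h • ((χ x)⁻¹ : kˣ) • ρ x m) fun x => ?_
  · rw [key]
  rw [Equiv.coe_mulLeft, smul_smul, map_mul χ, mul_inv_rev, mul_left_comm, mul_inv_cancel, mul_one,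
    map_mul ρ, Module.End.mul_apply, Units.smul_def, (ρ h).map_smul, ← Units.smul_def]

theorem eigenProj_eq_self [Finite H] (hH : (Nat.card H : k) ≠ 0) {m : M} (hm : ∀ h, ρ h m = χ h • m) :
    eigenProj ρ χ m = m := by
  cases nonempty_fintype H
  rw [eigenProj_apply]
  simp only [hm, smul_smul, inv_mul_cancel, one_smul]
  rw [Finset.sum_const, Finset.card_univ, ← Nat.card_eq_fintype_card, ← Nat.cast_smul_eq_nsmul k,
    smul_smul, inv_mul_cancel₀ hH, one_smul]

theorem map_eigenProj [Finite H] {M' : Type*} [AddCommGroup M'] [Module k M'] {ρ' : Representation k H M'}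
    (f : M →ₗ[k] M') (hf : ∀ h m, f (ρ h m) = ρ' h (f m)) (m : M) :
    f (eigenProj ρ χ m) = eigenProj ρ' χ (f m) := by
  cases nonempty_fintype H
  simp only [eigenProj_apply, map_smul, map_sum, Units.smul_def, hf]

/-- The functionals on a representation which transform by a linear character `χ`. -/
def equivariantFunctionals (ρ : Representation k H M) (χ : H →* kˣ) :
    Submodule k (Module.Dual k M) where
  carrier := {ψ | ∀ h m, ψ (ρ h m) = χ h • ψ m}
  zero_mem' := fun h m => by simp
  add_mem' := fun {ψ ψ'} hψ hψ' h m => by simp [hψ h m, hψ' h m]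
  smul_mem' := fun c ψ hψ h m => by simp [hψ h m, Units.smul_def, mul_left_comm]

/-- Functionals on a subrepresentation which transform by a linear character extend. -/
theorem exists_equivariant_extension [Finite H] (hH : (Nat.card H : k) ≠ 0)
    {M' : Type*} [AddCommGroup M'] [Module k M'] {ρ' : Representation k H M'}
    (f : M →ₗ[k] M') (hf : ∀ h m, f (ρ h m) = ρ' h (f m)) (hinj : Function.Injective f)
    {φ : Module.Dual k M} (hφ : φ ∈ equivariantFunctionals ρ χ) :
    ∃ ψ ∈ equivariantFunctionals ρ' χ, ψ ∘ₗ f = φ := by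
  obtain ⟨g, hg⟩ := f.exists_leftInverse_of_injective (LinearMap.ker_eq_bot.2 hinj)
  -- The retraction `g` is only linear, so `φ ∘ₗ g` is averaged. The dual action involves h⁻¹, so
  -- χ-equivariant functionals are the χ⁻¹-eigenvectors of the dual.
  refine ⟨eigenProj ρ'.dual χ⁻¹ (φ ∘ₗ g), fun h m => ?_, ?_⟩
  · have := LinearMap.congr_fun (apply_eigenProj (ρ := ρ'.dual) (χ := χ⁻¹) h⁻¹ (φ ∘ₗ g)) m
    simpa [Representation.dual_apply, Module.Dual.transpose_apply] using this
  · have := map_eigenProj (ρ := ρ'.dual) (ρ' := ρ.dual) (χ := χ⁻¹) (Module.Dual.transpose f)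
      (fun h ξ => by ext m; simp [Representation.dual_apply, Module.Dual.transpose_apply, hf])
      (φ ∘ₗ g)
    have hφg : (φ ∘ₗ g) ∘ₗ f = φ := by rw [LinearMap.comp_assoc, hg, LinearMap.comp_id]
    have hφ' : ∀ h, ρ.dual h φ = χ⁻¹ h • φ := by
      intro h
      ext m
      simpa [Representation.dual_apply, Module.Dual.transpose_apply, Units.smul_def]
        using hφ h⁻¹ m
    rw [Module.Dual.transpose_apply, Module.Dual.transpose_apply, hφg,
      eigenProj_eq_self hH hφ'] at this
    exact this

/-- An eigenvector is detected by a functional which transforms by the same character. -/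
theorem exists_equivariant_functional [Finite H] (hH : (Nat.card H : k) ≠ 0) {m : M}
    (hm : ∀ h, ρ h m = χ h • m) (hm0 : m ≠ 0) :
    ∃ ψ ∈ equivariantFunctionals ρ χ, ψ m ≠ 0 := by
  let τ : Representation k H k := (Algebra.lmul k k : k →* Module.End k k).comp
    ((Units.coeHom k).comp χ)
  obtain ⟨ψ, hψ, h⟩ := exists_equivariant_extension (ρ := τ) (ρ' := ρ) (χ := χ) hH
    (LinearMap.toSpanSingleton k M m)
    (fun h c => by simp [τ, hm, Units.smul_def, smul_smul, mul_comm])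
    (smul_left_injective k hm0) (φ := LinearMap.id)
    (fun h c => by simp [τ, Units.smul_def])
  refine ⟨ψ, hψ, ?_⟩
  have := LinearMap.congr_fun h 1
  simp at this
  simp [this]

end Averaging

/-! ### Bruhat decomposition -/

section Bruhat

/-- The Bruhat decomposition `G = B N B`. -/
theorem BNPair.exists_eq_mul_mul {G : Type*} [Group G] (D : BNPair G) (g : G) :
    ∃ b ∈ D.B, ∃ n : D.N, ∃ b' ∈ D.B, g = b * n * b' := by
  have := D.normal
  let A : Set G := {g | ∃ b ∈ D.B, ∃ n : D.N, ∃ b' ∈ D.B, g = b * n * b'}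
  have hB : ∀ b ∈ D.B, ∀ g ∈ A, b * g ∈ A := by
    rintro b hb _ ⟨b₁, hb₁, n, b₂, hb₂, rfl⟩
    exact ⟨b * b₁, Subgroup.mul_mem _ hb hb₁, n, b₂, hb₂, by group⟩
  have hS : ∀ n : D.N, (n : D.N ⧸ (D.B ⊓ D.N).subgroupOf D.N) ∈ D.S → ∀ g ∈ A, (n : G) * g ∈ A := by
    rintro n hn _ ⟨b, hb, m, b', hb', rfl⟩
    rcases D.mul_mem n hn m b hb with h | h <;>
      obtain ⟨c, hc, c', hc', h⟩ := DoubleCoset.mem_doubleCoset.1 h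
    · refine ⟨c, hc, n * m, c' * b', Subgroup.mul_mem _ hc' hb', ?_⟩
      rw [← mul_assoc, ← mul_assoc, h, Subgroup.coe_mul, mul_assoc _ c']
    · refine ⟨c, hc, m, c' * b', Subgroup.mul_mem _ hc' hb', ?_⟩
      rw [← mul_assoc, ← mul_assoc, h, mul_assoc _ c']
  have hN : ∀ w : D.N ⧸ (D.B ⊓ D.N).subgroupOf D.N, ∀ n : D.N,
      (n : D.N ⧸ (D.B ⊓ D.N).subgroupOf D.N) = w → ∀ g ∈ A, (n : G) * g ∈ A := by
    intro w
    have hw : w ∈ Subgroup.closure D.S := D.closure_S ▸ Subgroup.mem_top w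
    -- Generators are involutions, so `S` generates `W` as a monoid and the induction needs no
    -- inverse case.
    have hinv : D.S⁻¹ = D.S := by
      ext s
      have key : ∀ s ∈ D.S, s⁻¹ = s := fun s hs => by
        have := pow_orderOf_eq_one s
        rw [D.orderOf_S s hs, pow_two] at this
        exact inv_eq_of_mul_eq_one_left this
      constructor
      · intro hs
        have h1 := key _ hs
        rw [inv_inv] at h1
        rw [h1]; exact hs
      · intro hs
        rw [Set.mem_inv, key s hs]; exact hs
    rw [← Subgroup.mem_toSubmonoid, Subgroup.closure_toSubmonoid, hinv, Set.union_self] at hw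
    induction hw using Submonoid.closure_induction with
    | mem s hs => exact fun n hn => hS n (hn ▸ hs)
    | one =>
      intro n hn
      rw [QuotientGroup.eq_one_iff, Subgroup.mem_subgroupOf] at hn
      exact hB n hn.1
    | mul x y _ _ hx hy =>
      intro n hn g hg
      obtain ⟨a, rfl⟩ := QuotientGroup.mk_surjective x
      have := hx a rfl _ (hy (a⁻¹ * n) (by simp [hn]) g hg)
      simpa [mul_assoc] using this
  have h1 : (1 : G) ∈ A := ⟨1, one_mem _, 1, 1, one_mem _, by simp⟩
  have hg : g ∈ D.B ⊔ D.N := D.sup_eq_top ▸ Subgroup.mem_top g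
  -- Carrying g⁻¹ along makes the inverse case of the closure induction a swap.
  suffices h : (∀ a ∈ A, g * a ∈ A) ∧ ∀ a ∈ A, g⁻¹ * a ∈ A by
    have := h.1 1 h1
    rwa [mul_one] at this
  rw [Subgroup.sup_eq_closure] at hg
  induction hg using Subgroup.closure_induction with
  | mem x hx =>
    rcases hx with hx | hx
    · exact ⟨hB x hx, hB _ (inv_mem hx)⟩
    · exact ⟨hN _ ⟨x, hx⟩ rfl, hN _ ⟨x⁻¹, inv_mem hx⟩ rfl⟩
  | one => simp
  | mul x y _ _ hx hy =>
    simp only [mul_inv_rev, mul_assoc]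
    exact ⟨fun a ha => hx.1 _ (hy.1 _ ha), fun a ha => hy.2 _ (hx.2 _ ha)⟩
  | inv x _ hx => exact ⟨hx.2, by simpa using hx.1⟩

/-- A functional which transforms under `B` by a character `χ` vanishes on the representation
generated by a `χ`-eigenvector `m` of `B` as soon as it vanishes on `w m` for all `w ∈ W`. -/
theorem BNPair.functional_eq_zero {k : Type*} [Field k] {G : Type*} [Group G] (D : BNPair G)
    (χ : D.B →* kˣ) {M : Type*} [AddCommGroup M] [Module k M] {ρ : Representation k G M} {m : M}
    (hm : ∀ b : D.B, ρ b m = χ b • m) (hspan : Submodule.span k (Set.range fun g => ρ g m) = ⊤)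
    {ψ : Module.Dual k M} (hψ : ψ ∈ equivariantFunctionals (ρ.comp D.B.subtype) χ)
    (h0 : ∀ w : D.W, ψ (ρ (w.out : G) m) = 0) : ψ = 0 := by
  replace hψ : ∀ (b : D.B) (x : M), ψ (ρ b x) = χ b • ψ x := hψ
  refine LinearMap.ext_on_range hspan fun g => ?_
  obtain ⟨b, hb, n, b', hb', rfl⟩ := D.exists_eq_mul_mul g
  obtain ⟨t, ht⟩ := QuotientGroup.mk_out_eq_mul (D.T.subgroupOf D.N) n
  have ht' : (t : D.N).1⁻¹ ∈ D.B := inv_mem (Subgroup.mem_subgroupOf.1 t.2).1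
  -- `n` differs from the chosen representative by an element of `T ≤ B`, which acts on `m` by a
  -- scalar.
  have hn : (n : G) = ((n : D.W).out : G) * ((t : D.N) : G)⁻¹ := by
    rw [ht]; simp
  rw [hn, map_mul, map_mul, map_mul, Module.End.mul_apply, Module.End.mul_apply,
    Module.End.mul_apply, hψ ⟨b, hb⟩, hm ⟨b', hb'⟩]
  have h1 := hm ⟨_, ht'⟩
  simp only at h1
  rw [Units.smul_def (χ ⟨b', hb'⟩), map_smul, h1, Units.smul_def (χ ⟨_, ht'⟩), map_smul, map_smul,
    map_smul, map_smul, h0]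
  simp

end Bruhat

/-! ### Projective induced modules and the bound on Ext¹ -/

section Ext

/-- A space which embeds into the image of a finite-dimensional space is finite-dimensional, of
at most the same dimension. -/
theorem finite_and_finrank_le_of_range_le {k E F L : Type*} [Field k] [AddCommGroup E] [Module k E]
    [AddCommGroup F] [Module k F] [AddCommGroup L] [Module k L] [Module.Finite k E]
    (f : E →ₗ[k] F) (g : L →ₗ[k] F) (hg : Function.Injective g)
    (h : LinearMap.range g ≤ LinearMap.range f) :
    Module.Finite k L ∧ Module.finrank k L ≤ Module.finrank k E := by
  have : Module.Finite k (LinearMap.range g) := Submodule.finiteDimensional_of_le h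
  refine ⟨Module.Finite.equiv (LinearEquiv.ofInjective g hg).symm, ?_⟩
  rw [← LinearMap.finrank_range_of_inj hg]
  exact (Submodule.finrank_mono h).trans (LinearMap.finrank_range_le f)

/-- Given a short exact sequence `0 ⟶ X₁ ⟶ X₂ ⟶ X₃ ⟶ 0` with `X₂` projective, the connecting map
`Hom(X₁, V) ⟶ Ext¹(X₃, V)` is a surjective linear map. -/
theorem exists_surjective_to_ext_one (k : Type*) [CommRing k] {C : Type*} [Category C] [Abelian C]
    [Linear k C] [HasExt.{w} C] {S : ShortComplex C} (hS : S.ShortExact) [Projective S.X₂] (V : C) :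
    ∃ δ : (S.X₁ ⟶ V) →ₗ[k] Abelian.Ext.{w} S.X₃ V 1, Function.Surjective δ := by
  refine ⟨Abelian.Ext.precompOfLinear hS.extClass k V (add_zero 1) ∘ₗ
    (Abelian.Ext.linearEquiv₀ (R := k)).symm.toLinearMap, fun x => ?_⟩
  obtain ⟨y, hy⟩ := Abelian.Ext.contravariant_sequence_exact₃ hS V x
    (Abelian.Ext.eq_zero_of_projective _) (add_zero 1)
  exact ⟨Abelian.Ext.linearEquiv₀ (R := k) y, by simpa using hy⟩

variable {k : Type u} [Field k] {G : Type v} [Group G] [Finite G]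

/-- The representation of `G` induced from a linear character of a subgroup `H` of invertible order
is projective and generated by an eigenvector of `H`; every eigenvector of `H` in a
representation of `G` is the image of this generator. -/
theorem exists_projective_of_character (H : Subgroup G) (hH : (Nat.card H : k) ≠ 0)
    (χ : H →* kˣ) :
    ∃ (P : Rep.{max u v} k G) (e : P), Projective P ∧ (∀ h : H, P.ρ h e = χ h • e) ∧
      Submodule.span k (Set.range fun g => P.ρ g e) = ⊤ ∧
      ∀ (Y : Rep.{max u v} k G) (y : Y), (∀ h : H, Y.ρ h y = χ h • y) →
        ∃ f : P ⟶ Y, f.hom e = y := by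
  let A : Rep.{max u v} k G := Rep.leftRegular k G
  let one : A := MonoidAlgebra.single 1 1
  have leftRegularHom_one : ∀ (Y : Rep.{max u v} k G) (y : Y), (Y.leftRegularHom y).hom one = y := by
    intro Y y
    rw [Rep.leftRegularHom_hom_single, map_one, one_smul]; rfl
  have hext : ∀ {Y : Rep.{max u v} k G} {f f' : A ⟶ Y}, f.hom one = f'.hom one → f = f' :=
    fun {Y f f'} h => (Rep.leftRegularHomEquiv Y).injective h
  have hA : Projective A := by
    refine ⟨fun {Y Z} f q hq => ?_⟩
    obtain ⟨y, hy⟩ := (Rep.epi_iff_surjective q).1 hq (f.hom one)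
    exact ⟨Y.leftRegularHom y, hext ((congrArg q.hom (leftRegularHom_one Y y)).trans hy)⟩
  -- This is the idempotent of χ in `kG`; below, `R` is right multiplication by it and `P` is the
  -- left ideal `kG e`, a retract of `kG`.
  let e : A := eigenProj (A.ρ.comp H.subtype) χ one
  have he : ∀ h : H, A.ρ h e = χ h • e := fun h => apply_eigenProj (ρ := A.ρ.comp H.subtype) h one
  have hmap : ∀ (Y : Rep.{max u v} k G) (y : Y), (∀ h : H, Y.ρ h y = χ h • y) →
      (A.leftRegularHom e ≫ Y.leftRegularHom y).hom = (Y.leftRegularHom y).hom := by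
    intro Y y hy
    refine congrArg Rep.Hom.hom (hext ?_)
    change (Y.leftRegularHom y).hom ((A.leftRegularHom e).hom one) = (Y.leftRegularHom y).hom one
    rw [leftRegularHom_one, leftRegularHom_one]
    refine (map_eigenProj (ρ := A.ρ.comp H.subtype) (ρ' := Y.ρ.comp H.subtype)
      (Y.leftRegularHom y).hom.toLinearMap
      (fun h m => Rep.hom_comm_apply (Y.leftRegularHom y) h m) one).trans ?_
    change eigenProj _ χ ((Y.leftRegularHom y).hom one) = y
    rw [leftRegularHom_one]
    exact eigenProj_eq_self hH hy
  let R : A ⟶ A := A.leftRegularHom e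
  have hR : ∀ x, R.hom (R.hom x) = R.hom x := fun x =>
    DFunLike.congr_fun (hmap A e he) x
  let Q : Submodule k A := LinearMap.range R.hom.toLinearMap
  have hQ : ∀ g, Q ≤ Q.comap (A.ρ g) := by
    rintro g _ ⟨x, rfl⟩
    exact ⟨A.ρ g x, Rep.hom_comm_apply R g x⟩
  let P : Rep.{max u v} k G := A.subrepresentation Q hQ
  let i : P ⟶ A := A.subtype Q hQ
  let q : A ⟶ P := Rep.ofHom ⟨R.hom.toLinearMap.rangeRestrict, fun g => by
    refine LinearMap.ext fun x => ?_
    exact Subtype.ext (Rep.hom_comm_apply R g x)⟩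
  have hiq : i ≫ q = 𝟙 P := by
    refine Rep.hom_ext (DFunLike.ext _ _ ?_)
    rintro ⟨_, x, rfl⟩
    exact Subtype.ext (hR x)
  refine ⟨P, q.hom one, Retract.projective ⟨i, q, hiq⟩, fun h => Subtype.ext ?_, ?_,
    fun Y y hy => ⟨i ≫ Y.leftRegularHom y, ?_⟩⟩
  · change A.ρ h (R.hom one) = χ h • R.hom one
    rw [leftRegularHom_one A e, he]
  · rw [eq_top_iff]
    rintro ⟨_, x, rfl⟩ -
    change q.hom x ∈ _
    induction x using MonoidAlgebra.induction_linear with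
    | zero => rw [map_zero]; exact zero_mem _
    | add x y hx hy => rw [map_add]; exact add_mem hx hy
    | single g c =>
      have : (MonoidAlgebra.single g c : A) = c • A.ρ g one := by simp [A, one]
      rw [this, map_smul, Rep.hom_comm_apply]
      exact Submodule.smul_mem _ _ (Submodule.subset_span ⟨g, rfl⟩)
  · have := DFunLike.congr_fun (hmap Y y hy) one
    exact this.trans (leftRegularHom_one Y y)

/-- Let `P` be a representation of `G` generated by an eigenvector of `B` for a linear character, and
let `V` be an irreducible representation containing an eigenvector of `B` for the same character.
If the order of `B` is invertible, then `dim Hom(K, V) ≤ |W|` for every subrepresentation `K` of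
`P`. -/
theorem BNPair.finite_and_finrank_hom_le (D : BNPair G) (hB : (Nat.card D.B : k) ≠ 0)
    (χ : D.B →* kˣ) {K P V : Rep.{max u v} k G} (ι : K ⟶ P) [Mono ι]
    {e : P} (he : ∀ b : D.B, P.ρ b e = χ b • e)
    (hspan : Submodule.span k (Set.range fun g => P.ρ g e) = ⊤) (hV : V.ρ.IsIrreducible)
    {v : V} (hv : ∀ b : D.B, V.ρ b v = χ b • v) (hv0 : v ≠ 0) :
    Module.Finite k (K ⟶ V) ∧ Module.finrank k (K ⟶ V) ≤ Nat.card D.W := by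
  obtain ⟨l, hl, hlv⟩ := exists_equivariant_functional (ρ := V.ρ.comp D.B.subtype) hB hv hv0
  let E := equivariantFunctionals (P.ρ.comp D.B.subtype) χ
  let ev : E →ₗ[k] D.W → k :=
    LinearMap.pi fun w => LinearMap.applyₗ (P.ρ (w.out : G) e) ∘ₗ E.subtype
  have hev : Function.Injective ev := by
    rw [injective_iff_map_eq_zero]
    exact fun ψ hψ => Subtype.ext (D.functional_eq_zero χ he hspan ψ.2 fun w => congrFun hψ w)
  have hEfin : Module.Finite k E := Module.Finite.of_injective ev hev
  let res : E →ₗ[k] Module.Dual k K := Module.Dual.transpose ι.hom.toLinearMap ∘ₗ E.subtype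
  let Φ : (K ⟶ V) →ₗ[k] Module.Dual k K :=
    { toFun := fun g => l ∘ₗ g.hom.toLinearMap
      map_add' := fun g g' => LinearMap.comp_add _ _ _
      map_smul' := fun c g => LinearMap.comp_smul _ _ _ }
  have hΦres : LinearMap.range Φ ≤ LinearMap.range res := by
    rintro _ ⟨g, rfl⟩
    obtain ⟨ψ, hψ, h⟩ := exists_equivariant_extension (ρ := K.ρ.comp D.B.subtype)
      (ρ' := P.ρ.comp D.B.subtype) (χ := χ) hB ι.hom.toLinearMap
      (fun b m => Rep.hom_comm_apply ι b m) ((Rep.mono_iff_injective ι).1 inferInstance)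
      (φ := Φ g) (fun b m => by
        change l (g.hom (K.ρ b m)) = χ b • l (g.hom m)
        rw [Rep.hom_comm_apply]
        exact hl b _)
    exact ⟨⟨ψ, hψ⟩, h⟩
  -- A nonzero map into the irreducible `V` hits `v`, where `l` does not vanish.
  have hΦ : Function.Injective Φ := by
    rw [injective_iff_map_eq_zero]
    intro g hg
    refine Rep.hom_ext ((Representation.IsIrreducible.surjective_or_eq_zero g.hom).resolve_left
      fun h => hlv ?_)
    obtain ⟨x, hx⟩ := h v
    rw [← hx]
    exact LinearMap.congr_fun hg x
  clear_value res Φ ev E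
  obtain ⟨hfin, hle⟩ := finite_and_finrank_le_of_range_le (E := E) (F := Module.Dual k K)
    (L := K ⟶ V) res Φ hΦ hΦres
  refine ⟨hfin, hle.trans ((LinearMap.finrank_le_finrank_of_injective hev).trans_eq ?_)⟩
  cases nonempty_fintype D.W
  rw [Module.finrank_fintype_fun_eq_card, Nat.card_eq_fintype_card]

/-- If `Y` and `V` are irreducible representations of a finite group `G` with a `BN`-pair, both
containing eigenvectors of `B` for the same linear character, and the order of `B` is invertible,
then `dim Ext¹(Y, V) ≤ |W|`. -/
theorem BNPair.rank_ext_one_le (D : BNPair G) (hB : (Nat.card D.B : k) ≠ 0) (χ : D.B →* kˣ)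
    (Y V : Rep.{max u v} k G) (hY : Y.ρ.IsIrreducible) (hV : V.ρ.IsIrreducible)
    {y : Y} (hy : ∀ b : D.B, Y.ρ b y = χ b • y) (hy0 : y ≠ 0)
    {v : V} (hv : ∀ b : D.B, V.ρ b v = χ b • v) (hv0 : v ≠ 0) :
    Module.rank k (Abelian.Ext.{max u v} Y V 1) ≤ (Nat.card D.W : Cardinal) := by
  obtain ⟨P, e, hP, he, hspan, hlift⟩ := exists_projective_of_character D.B hB χ
  obtain ⟨f, hf⟩ := hlift Y y hy
  have hepi : Epi f := by
    rw [Rep.epi_iff_surjective]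
    refine (Representation.IsIrreducible.surjective_or_eq_zero f.hom).resolve_right fun h => hy0 ?_
    rw [← hf, h]; rfl
  let S := ShortComplex.kernelSequence f
  have hS : S.ShortExact :=
    { exact := ShortComplex.kernelSequence_exact f
      mono_f := inferInstance
      epi_g := hepi }
  have : Projective S.X₂ := hP
  obtain ⟨δ, hδ⟩ := exists_surjective_to_ext_one k hS V
  have := hS.mono_f
  obtain ⟨hfin, hle⟩ := D.finite_and_finrank_hom_le hB χ S.f he hspan hV hv hv0
  have hExtfin : Module.Finite k (Abelian.Ext.{max u v} Y V 1) := Module.Finite.of_surjective δ hδ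
  rw [← Module.finrank_eq_rank, Nat.cast_le]
  exact (LinearMap.finrank_le_finrank_of_surjective hδ).trans hle

end Ext

/-! ### From the principal series to eigenvectors of `B` -/

section PrincipalSeries

variable {k : Type*} [Field k] {p : ℕ} {G : Type*} [Group G] (D : SplitBNPair p G)

/-- A linear character of `T` inflates to `B = U ⋊ T`. -/
theorem SplitBNPair.exists_inflation (χ : D.T →* kˣ) :
    ∃ χ' : D.B →* kˣ, (∀ u (hu : u ∈ D.U), χ' ⟨u, D.U_le_B hu⟩ = 1) ∧
      ∀ t : D.T, χ' ⟨t, t.2.1⟩ = χ t := by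
  have := D.U_normal
  -- This identifies `B / U` with `T`, through which the character is pulled back.
  have hc : (D.T.subgroupOf D.B).IsComplement' (D.U.subgroupOf D.B) := by
    refine Subgroup.IsComplement'.symm (Subgroup.isComplement'_of_disjoint_and_mul_eq_univ ?_ ?_)
    · rw [disjoint_iff]
      change Subgroup.comap _ (D.U ⊓ (D.B ⊓ D.N)) = ⊥
      rw [D.U_inf_T]
      simp
    · rw [← Subgroup.normal_mul, ← Subgroup.subgroupOf_sup D.U_le_B inf_le_left]
      rw [show D.U ⊔ D.T = D.B from D.U_sup_T]
      simp
  let τ : D.T.subgroupOf D.B ≃* D.T := Subgroup.subgroupOfEquivOfLe inf_le_left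
  let q : D.B →* D.T := (τ.toMonoidHom.comp hc.QuotientMulEquiv.toMonoidHom).comp
    (QuotientGroup.mk' (D.U.subgroupOf D.B))
  refine ⟨χ.comp q, fun u hu => ?_, fun t => ?_⟩
  · have : QuotientGroup.mk' (D.U.subgroupOf D.B) ⟨u, D.U_le_B hu⟩ = 1 :=
      (QuotientGroup.eq_one_iff _).2 hu
    simp only [q, MonoidHom.comp_apply, this, map_one]
  · have : hc.QuotientMulEquiv (QuotientGroup.mk' (D.U.subgroupOf D.B) ⟨t, t.2.1⟩)
        = ⟨⟨t, t.2.1⟩, t.2⟩ := by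
      rw [← MulEquiv.eq_symm_apply]
      rfl
    change χ (τ (hc.QuotientMulEquiv _)) = χ t
    rw [this]
    rfl

/-- A one-dimensional representation is given by a linear character. -/
theorem exists_character_of_finrank_eq_one {H : Type*} [Group H] {X : Type*} [AddCommGroup X]
    [Module k X] (σ : Representation k H X) (hX : Module.finrank k X = 1) :
    ∃ χ : H →* kˣ, ∀ h x, σ h x = χ h • x := by
  refine ⟨MonoidHom.toHomUnits ((LinearMap.det : Module.End k X →* k).comp σ), fun h x => ?_⟩
  obtain ⟨c, hc, -⟩ := LinearMap.existsUnique_eq_smul_id_of_finrank_eq_one hX (σ h)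
  simp [Units.smul_def, hc, hX]

/-- A representation in the principal series of a linear character of `T` contains an eigenvector
of `B` for the inflated character. -/
theorem SplitBNPair.InPrincipalSeries.exists_eigenvector [Finite G]
    (hT : (Nat.card D.T : k) ≠ 0) {X : Type*} [AddCommGroup X] [Module k X]
    {σ : Representation k D.T X} {χ : D.T →* kˣ} (hσ : ∀ t x, σ t x = χ t • x)
    {χ' : D.B →* kˣ} (hU : ∀ u (hu : u ∈ D.U), χ' ⟨u, D.U_le_B hu⟩ = 1)
    (hχ' : ∀ t : D.T, χ' ⟨t, t.2.1⟩ = χ t) (hX : Module.finrank k X = 1)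
    {M : Type*} [AddCommGroup M] [Module k M] {ρ : Representation k G M}
    (h : D.InPrincipalSeries σ ρ) : ∃ m : M, (∀ b : D.B, ρ b m = χ' b • m) ∧ m ≠ 0 := by
  obtain ⟨-, -, A, f, hf⟩ := h
  have : Nontrivial X := Module.nontrivial_of_finrank_pos (R := k) (by omega)
  obtain ⟨x, hx⟩ := exists_ne (0 : X)
  obtain ⟨a, rfl⟩ := hf x
  -- Averaging turns a lift of a vector of the subquotient into a true eigenvector of `T`. Its image
  -- in `X` is unchanged, hence nonzero, because `T` acts on `X` by χ.
  let m := eigenProj A.toRepresentation χ a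
  have hfm : f m = f a := by
    refine (map_eigenProj (ρ := A.toRepresentation) (ρ' := σ) f.toLinearMap
      f.isIntertwining a).trans ?_
    exact eigenProj_eq_self hT fun t => hσ t _
  refine ⟨(m : Representation.invariants (ρ.comp D.U.subtype)), fun b => ?_, fun h0 => hx ?_⟩
  · obtain ⟨b, hb⟩ := b
    have hT' : D.T ≤ Subgroup.normalizer (D.U : Set G) := inf_le_left.trans
      ((Subgroup.normal_subgroupOf_iff_le_normalizer D.U_le_B).1 D.U_normal)
    have hb' : b ∈ (D.U : Set G) * (D.T : Set G) := by
      rw [← Subgroup.coe_mul_of_right_le_normalizer_left _ _ hT']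
      exact D.U_sup_T.symm ▸ hb
    obtain ⟨u, hu, t, ht, rfl⟩ := hb'
    have hmu : ρ u (m.1.1 : M) = m.1.1 := m.1.2 ⟨u, hu⟩
    have hmt : ρ t (m.1.1 : M) = χ ⟨t, ht⟩ • (m.1.1 : M) :=
      congrArg (fun z => (z.1.1 : M)) (apply_eigenProj (ρ := A.toRepresentation) (χ := χ) ⟨t, ht⟩ a)
    have hχb : χ' ⟨u * t, hb⟩ = χ ⟨t, ht⟩ := by
      rw [← hχ' ⟨t, ht⟩, ← one_mul (χ' ⟨t, _⟩), ← hU u hu, ← map_mul]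
      rfl
    change ρ (u * t) (m.1.1 : M) = χ' ⟨u * t, hb⟩ • (m.1.1 : M)
    rw [map_mul, Module.End.mul_apply, hmt, Units.smul_def, map_smul, hmu, hχb, Units.smul_def]
  · rw [← hfm, show m = 0 from Subtype.ext (Subtype.ext h0), map_zero]

end PrincipalSeries

theorem mainTheorem7 {p r : ℕ} (hp : p.Prime) (hr : 0 < r) (hrp : r ≠ p)
    {k : Type u} [Field k] [IsAlgClosed k] [CharP k r]
    {G : Type v} [Group G] [Finite G] (D : SplitBNPair p G)
    (hB : ¬ r ∣ Nat.card D.B)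
    {X : Type w} [AddCommGroup X] [Module k X] (σ : Representation k D.T X)
    (hX : Module.finrank k X = 1)
    (Y V : Rep.{max u v} k G)
    (hY : D.InPrincipalSeries σ Y.ρ) (hV : D.InPrincipalSeries σ V.ρ) :
    Module.rank k (Abelian.Ext.{max u v} Y V 1) ≤ (Nat.card D.W : Cardinal) := by
  have hB' : (Nat.card D.B : k) ≠ 0 := fun h => hB ((CharP.cast_eq_zero_iff k r _).1 h)
  have hT : (Nat.card D.T : k) ≠ 0 := fun h => hB
    (((CharP.cast_eq_zero_iff k r _).1 h).trans (Subgroup.card_dvd_of_le inf_le_left))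
  obtain ⟨χ, hχ⟩ := exists_character_of_finrank_eq_one σ hX
  obtain ⟨χ', hU, hχ'⟩ := D.exists_inflation χ
  obtain ⟨y, hy, hy0⟩ := hY.exists_eigenvector D hT hχ hU hχ' hX
  obtain ⟨v, hv, hv0⟩ := hV.exists_eigenvector D hT hχ hU hχ' hX
  exact D.rank_ext_one_le hB' χ' Y V hY.1 hV.1 hy hy0 hv hv0
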